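/- Let $h_7(z)=\sum_{n\ge 0}c_nz^n$, where the $c_n$ are determined by $c_{-1}=0$, $c_0=1$ and $$(3n-1)^2c_{n-1}+3(39n^2+26n+7)c_n+441(n+1)^2c_{n+1}=0\qquad(n\ge 0).$$ This series converges in a neighborhood of $0\in\mathbb{C}$. Equivalently, for all $z$ in a neighborhood of $0$, $$h_7(z)=\left[\tfrac1{49}(z^2+5z+1)^3(z^2+13z+49)\right]^{-1/12}{}_2F_1\left(\tfrac1{12},\tfrac5{12};1;\tfrac{1728\,z}{(z^2+5z+1)^3(z^2+13z+49)}\right).$$ Let $z=z(t)$, $z'=z'(t)$ be the functions defined implicitly in a (punctured) neighborhood of $t=\infty$ in $\mathbb{P}^1(\mathbb{C})$ by $$z+\frac{49}{z'}=(t^3-7t^2+14t-7)(t^4-14t^3+63t^2-98t+35),\qquad z\cdot\frac{49}{z'}=49(t^3-7t^2+14t-7)^2,$$ on the branch where $z,z'\to0$ as $t\to\infty$ (near $t=\infty$ this branch exists, is unique, and is analytic in $t$). Then for all $t\in\mathbb{C}$ of sufficiently large modulus, $$h_7(z(t))=7\left[\frac{z(t)^7}{z'(t)}\right]^{-1/12}h_7(z'(t)).$$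 All powers $[\,\cdot\,]^{-1/12}$ are principal branches. (Here $z'$ is a second function, not the derivative of $z$.) -/

import Mathlib

open Filter Topology

noncomputable section

/-- The coefficients `c_n` given by `c_{-1} = 0`, `c_0 = 1` and
`(3n-1)² c_{n-1} + 3(39n²+26n+7) c_n + 441(n+1)² c_{n+1} = 0` for `n ≥ 0`
(see `h7Coeff_recurrence`). -/
def h7Coeff : ℕ → ℂ
  | 0 => 1
  | 1 => -1 / 21
  | n + 2 =>
      -((3 * ((n : ℂ) + 1) - 1) ^ 2 * h7Coeff n
          + 3 * (39 * ((n : ℂ) + 1) ^ 2 + 26 * ((n : ℂ) + 1) + 7) * h7Coeff (n + 1))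
        / (441 * ((n : ℂ) + 2) ^ 2)

/-- The three-term recurrence; the `if` is the convention `c_{-1} = 0`. -/
theorem h7Coeff_recurrence (n : ℕ) :
    (3 * (n : ℂ) - 1) ^ 2 * (if n = 0 then 0 else h7Coeff (n - 1))
      + 3 * (39 * (n : ℂ) ^ 2 + 26 * (n : ℂ) + 7) * h7Coeff n
      + 441 * ((n : ℂ) + 1) ^ 2 * h7Coeff (n + 1) = 0 := by
  cases n with
  | zero => norm_num [h7Coeff]
  | succ m =>
    have hm : (m : ℂ) + 2 ≠ 0 := by exact_mod_cast Nat.succ_ne_zero (m + 1)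
    have e : h7Coeff (m + 1 + 1) =
        -((3 * ((m : ℂ) + 1) - 1) ^ 2 * h7Coeff m
          + 3 * (39 * ((m : ℂ) + 1) ^ 2 + 26 * ((m : ℂ) + 1) + 7) * h7Coeff (m + 1))
        / (441 * ((m : ℂ) + 2) ^ 2) := by
      rw [h7Coeff]
    rw [e]
    simp only [Nat.succ_ne_zero, if_false, Nat.add_sub_cancel]
    push_cast
    field_simp
    ring

/-- The power series `h₇(z) = ∑ c_n zⁿ`. -/
def h7 (z : ℂ) : ℂ := ∑' n : ℕ, h7Coeff n * z ^ n

/-- `z` and `z'` are functions of `t`, of interest only near `t = ∞`, which satisfy there the two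
equations for the sum and the product of `z` and `49/z'`, on the branch where `z, z' → 0`. -/
structure IsH7Branch (z z' : ℂ → ℂ) : Prop where
  sum_eq : ∀ᶠ t in Bornology.cobounded ℂ,
    z t + 49 / z' t =
      (t ^ 3 - 7 * t ^ 2 + 14 * t - 7) * (t ^ 4 - 14 * t ^ 3 + 63 * t ^ 2 - 98 * t + 35)
  prod_eq : ∀ᶠ t in Bornology.cobounded ℂ,
    z t * (49 / z' t) = 49 * (t ^ 3 - 7 * t ^ 2 + 14 * t - 7) ^ 2
  tendsto_left : Tendsto z (Bornology.cobounded ℂ) (𝓝 0)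
  tendsto_right : Tendsto z' (Bornology.cobounded ℂ) (𝓝 0)

end

/-! Put `x = 1/t`, `r = 1 - 7x + 7x²`, `ρ = 1 - 7x + 14x² - 7x³`. Writing `z = xρg²` and `z' =
x⁷g²/ρ` makes the product equation automatic, and the sum equation becomes `(x⁴g + 7/g)² = r²`.
Hence the branch comes from the analytic root `g`, `g(0) = 7`, of `x⁴g² - rg + 7 = 0`, and `z⁷/z' =
ρ⁸g¹²`.

The recurrence says that `h7` solves a second-order equation in `θ = z d/dz` (`h7_theta_relation`).
Pulling it back along `z`, and along `z'` with the twist `A = 7(ρ⁸g¹²)^(-1/12)`, gives one and the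
same equation for the derivation `ϑ = xS d/dx`, `S = r - 2x⁴g` (`septic_left_solvesODE`,
`septic_right_solvesODE`). The agreement is algebra modulo the quadratic relation for `g`. It rests
on the factorizations `z² + 13z + 49 = (1-x)g²b³` and `z'² + 13z' + 49 = (1-x)c³/(ρ²g)`, where `b =
1 + (1-2x)x²g` and `c = 7(1-2x) + x²g`, and on `ϑz/z = 7b²/(gρ)`, `ϑz'/z' = c²/(gρ)`.

At `x = 0` this equation has the double exponent `0`, so an analytic solution is fixed by its value
there (`SolvesODE.eventuallyEq`). Both sides equal `1` at `x = 0`. The hypergeometric formula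
follows from the same uniqueness and pullback principles. -/

/-! ### Power series with polynomially bounded coefficients -/

section PowerSeries

variable {c : ℕ → ℂ} {k : ℕ}

theorem norm_term_le_of_polynomial_growth (hc : ∀ n, ‖c n‖ ≤ (n : ℝ) ^ k) {r : ℝ} {w : ℂ}
    (hw : ‖w‖ ≤ r) (n : ℕ) : ‖c n * w ^ n‖ ≤ (n : ℝ) ^ k * r ^ n := by
  rw [norm_mul, norm_pow]
  gcongr
  exact hc n

theorem summable_of_polynomial_growth (hc : ∀ n, ‖c n‖ ≤ (n : ℝ) ^ k) {z : ℂ} (hz : ‖z‖ < 1) :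
    Summable fun n => c n * z ^ n :=
  Summable.of_norm_bounded
    (summable_pow_mul_geometric_of_norm_lt_one (R := ℝ) k (r := ‖z‖) (by simpa using hz))
    (norm_term_le_of_polynomial_growth hc le_rfl)

theorem analyticAt_tsum_of_polynomial_growth (hc : ∀ n, ‖c n‖ ≤ (n : ℝ) ^ k) {z : ℂ}
    (hz : ‖z‖ < 1) : AnalyticAt ℂ (fun w => ∑' n, c n * w ^ n) z := by
  obtain ⟨r, hzr, hr⟩ := exists_between hz
  have hr0 : 0 ≤ r := (norm_nonneg z).trans hzr.le
  have hd : DifferentiableOn ℂ (fun w => ∑' n, c n * w ^ n) (Metric.ball 0 r) :=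
    Complex.differentiableOn_tsum_of_summable_norm
      (summable_pow_mul_geometric_of_norm_lt_one (R := ℝ) k (r := r)
        (by rwa [Real.norm_of_nonneg hr0]))
      (fun n => by fun_prop) Metric.isOpen_ball
      (fun n w hw => norm_term_le_of_polynomial_growth hc (by simpa using (Metric.mem_ball.1 hw).le) n)
  exact hd.analyticAt (Metric.isOpen_ball.mem_nhds (by simpa using hzr))

theorem mul_deriv_tsum_of_polynomial_growth (hc : ∀ n, ‖c n‖ ≤ (n : ℝ) ^ k) {z : ℂ}
    (hz : ‖z‖ < 1) :
    z * deriv (fun w => ∑' n, c n * w ^ n) z = ∑' n : ℕ, ((n : ℂ) * c n) * z ^ n := by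
  obtain ⟨r, hzr, hr⟩ := exists_between hz
  have hr0 : 0 ≤ r := (norm_nonneg z).trans hzr.le
  have h := Complex.hasSum_deriv_of_summable_norm (F := fun (n : ℕ) w => c n * w ^ n)
      (U := Metric.ball 0 r) (z := z)
      (summable_pow_mul_geometric_of_norm_lt_one (R := ℝ) k (r := r)
        (by rwa [Real.norm_of_nonneg hr0]))
      (fun n => by fun_prop) Metric.isOpen_ball
      (fun n w hw => norm_term_le_of_polynomial_growth hc (by simpa using (Metric.mem_ball.1 hw).le) n)
      (by simpa using hzr)
  rw [← (h.mul_left z).tsum_eq]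
  refine tsum_congr fun n => ?_
  have hd : deriv (fun w : ℂ => c n * w ^ n) z = c n * (n * z ^ (n - 1)) :=
    ((hasDerivAt_pow n z).const_mul (c n)).deriv
  rw [hd]
  cases n with
  | zero => simp
  | succ n => rw [Nat.add_sub_cancel, pow_succ]; ring

theorem natCast_mul_polynomial_growth {c : ℕ → ℂ} {k : ℕ} (hc : ∀ n, ‖c n‖ ≤ (n : ℝ) ^ k) (n : ℕ) :
    ‖(n : ℂ) * c n‖ ≤ (n : ℝ) ^ (k + 1) := by
  rw [norm_mul, Complex.norm_natCast, pow_succ']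
  gcongr
  exact hc n

end PowerSeries

/-! ### The differential equations of `h7` and of the Gauss function -/

/-- Near `0`, `h` satisfies `θ² h = p θ h + q h` with `θ = z d/dz`, and `h₁ = θ h`. -/
structure SolvesThetaODE (p q h h₁ : ℂ → ℂ) : Prop where
  analytic : AnalyticAt ℂ h 0
  analytic_theta : AnalyticAt ℂ h₁ 0
  theta_eq : ∀ᶠ z in 𝓝 0, z * deriv h z = h₁ z
  theta_theta_eq : ∀ᶠ z in 𝓝 0, z * deriv h₁ z = p z * h₁ z + q z * h z

theorem solvesThetaODE_of_tsum {c : ℕ → ℂ} (hc : ∀ n, ‖c n‖ ≤ 1) {p q : ℂ → ℂ}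
    (h : ∀ᶠ z in 𝓝 (0 : ℂ), ∑' n : ℕ, ((n : ℂ) * (n * c n)) * z ^ n =
      p z * ∑' n : ℕ, (n * c n) * z ^ n + q z * ∑' n, c n * z ^ n) :
    SolvesThetaODE p q (fun z => ∑' n, c n * z ^ n) (fun z => ∑' n : ℕ, (n * c n) * z ^ n) := by
  have hc0 : ∀ n : ℕ, ‖c n‖ ≤ (n : ℝ) ^ 0 := by simpa using hc
  have hc1 := natCast_mul_polynomial_growth hc0
  have hball : ∀ᶠ z in 𝓝 (0 : ℂ), ‖z‖ < 1 := by
    filter_upwards [Metric.ball_mem_nhds (0 : ℂ) one_pos] with z hz using by simpa using hz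
  refine ⟨analyticAt_tsum_of_polynomial_growth hc0 (by simp),
    analyticAt_tsum_of_polynomial_growth hc1 (by simp), ?_, ?_⟩
  · filter_upwards [hball] with z hz using mul_deriv_tsum_of_polynomial_growth hc0 hz
  · filter_upwards [hball, h] with z hz h
    rw [mul_deriv_tsum_of_polynomial_growth hc1 hz, h]

theorem norm_h7Coeff_le (n : ℕ) : ‖h7Coeff n‖ ≤ 1 := by
  induction n using Nat.twoStepInduction with
  | zero => simp [h7Coeff]
  | one => norm_num [h7Coeff]
  | more n h0 h1 =>
    rw [h7Coeff, norm_div, norm_neg]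
    have e1 : ‖(441 * ((n : ℂ) + 2) ^ 2)‖ = 441 * ((n : ℝ) + 2) ^ 2 := by
      rw [← Complex.norm_of_nonneg (r := 441 * ((n : ℝ) + 2) ^ 2) (by positivity)]
      push_cast; rfl
    have e2 : ‖((3 * ((n : ℂ) + 1) - 1) ^ 2)‖ = (3 * (n : ℝ) + 2) ^ 2 := by
      rw [← Complex.norm_of_nonneg (r := (3 * (n : ℝ) + 2) ^ 2) (by positivity)]
      push_cast; ring_nf
    have e3 : ‖(3 * (39 * ((n : ℂ) + 1) ^ 2 + 26 * ((n : ℂ) + 1) + 7))‖ =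
        3 * (39 * ((n : ℝ) + 1) ^ 2 + 26 * ((n : ℝ) + 1) + 7) := by
      rw [← Complex.norm_of_nonneg
        (r := 3 * (39 * ((n : ℝ) + 1) ^ 2 + 26 * ((n : ℝ) + 1) + 7)) (by positivity)]
      push_cast; rfl
    rw [e1, div_le_one (by positivity)]
    refine (norm_add_le _ _).trans ?_
    rw [norm_mul, norm_mul, e2, e3]
    have hn : (0 : ℝ) ≤ n := n.cast_nonneg
    have a1 := mul_le_of_le_one_right (a := (3 * (n : ℝ) + 2) ^ 2) (by positivity) h0
    have a2 := mul_le_of_le_one_right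
      (a := 3 * (39 * ((n : ℝ) + 1) ^ 2 + 26 * ((n : ℝ) + 1) + 7)) (by positivity) h1
    -- The leading coefficients satisfy `9 + 117 < 441`, with room for the lower-order terms.
    nlinarith

theorem hasSum_h7 {z : ℂ} (hz : ‖z‖ < 1) : HasSum (fun n => h7Coeff n * z ^ n) (h7 z) :=
  (summable_of_polynomial_growth (k := 0) (by simpa using norm_h7Coeff_le) hz).hasSum

theorem h7_zero : h7 0 = 1 := by
  rw [h7, tsum_eq_single 0 (fun n hn => by simp [hn])]
  simp [h7Coeff]

theorem h7_theta_relation {z : ℂ} (hz : ‖z‖ < 1) :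
    9 * (z ^ 2 + 13 * z + 49) * (∑' n : ℕ, ((n : ℂ) * (n * h7Coeff n)) * z ^ n) +
      6 * (2 * z ^ 2 + 13 * z) * (∑' n : ℕ, (n * h7Coeff n) * z ^ n) +
      (4 * z ^ 2 + 21 * z) * (∑' n : ℕ, h7Coeff n * z ^ n) = 0 := by
  have hc0 : ∀ n : ℕ, ‖h7Coeff n‖ ≤ (n : ℝ) ^ 0 := by simpa using norm_h7Coeff_le
  have hc1 := natCast_mul_polynomial_growth hc0
  have s0 := (summable_of_polynomial_growth hc0 hz).hasSum
  have s1 := (summable_of_polynomial_growth hc1 hz).hasSum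
  have s2 := (summable_of_polynomial_growth (natCast_mul_polynomial_growth hc1) hz).hasSum
  set A0 := ∑' n : ℕ, h7Coeff n * z ^ n
  set A1 := ∑' n : ℕ, (n * h7Coeff n) * z ^ n
  set A2 := ∑' n : ℕ, ((n : ℂ) * (n * h7Coeff n)) * z ^ n
  have t0 := ((((s2.mul_left 9).add (s1.mul_left 12)).add (s0.mul_left 4)).mul_left (z ^ 2))
  have t1 := ((((s2.mul_left 117).add (s1.mul_left 78)).add (s0.mul_left 21)).mul_left z)
  have t2 := (hasSum_nat_add_iff' 1).2 (s2.mul_left 441)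
  have t1' := (hasSum_nat_add_iff' 1).2 t1
  have t2' := (hasSum_nat_add_iff' 1).2 t2
  -- All three series now run over `z^(n+2)`, with total coefficient the recurrence at `n + 1`. The
  -- split-off terms `21 c₀ z` and `441 c₁ z` cancel because `c₁ = -1/21`.
  have key := (t0.add t1').add t2'
  have := key.unique (hasSum_zero.congr_fun fun n => by
    have := h7Coeff_recurrence (n + 1)
    simp only [Nat.add_sub_cancel, Nat.succ_ne_zero, if_false] at this
    push_cast at this ⊢
    linear_combination z ^ (n + 2) * this)
  simp [h7Coeff] at this
  linear_combination this

theorem h7_solvesThetaODE :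
    SolvesThetaODE (fun z => -(2 / 3) * (2 * z ^ 2 + 13 * z) / (z ^ 2 + 13 * z + 49))
      (fun z => -(4 * z ^ 2 + 21 * z) / (9 * (z ^ 2 + 13 * z + 49)))
      h7 (fun z => ∑' n : ℕ, (n * h7Coeff n) * z ^ n) := by
  refine solvesThetaODE_of_tsum norm_h7Coeff_le ?_
  have hD : ∀ᶠ z : ℂ in 𝓝 0, z ^ 2 + 13 * z + 49 ≠ 0 :=
    ContinuousAt.eventually_ne (by fun_prop) (by norm_num)
  filter_upwards [Metric.ball_mem_nhds (0 : ℂ) one_pos, hD] with z hz hD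
  have := h7_theta_relation (z := z) (by simpa using hz)
  generalize ∑' n : ℕ, ((n : ℂ) * (n * h7Coeff n)) * z ^ n = A2 at this ⊢
  generalize ∑' n : ℕ, (n * h7Coeff n) * z ^ n = A1 at this ⊢
  generalize ∑' n : ℕ, h7Coeff n * z ^ n = A0 at this ⊢
  generalize z ^ 2 + 13 * z + 49 = D at this hD ⊢
  field_simp
  linear_combination 3 * this

theorem ordinaryHypergeometricCoefficient_one_succ (a b : ℂ) (n : ℕ) :
    ((n : ℂ) + 1) ^ 2 * ordinaryHypergeometricCoefficient a b 1 (n + 1) =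
      (a + n) * (b + n) * ordinaryHypergeometricCoefficient a b 1 n := by
  have h : ((n : ℂ) + 1) ≠ 0 := by exact_mod_cast n.succ_ne_zero
  have hf : (n.factorial : ℂ) ≠ 0 := by exact_mod_cast n.factorial_ne_zero
  simp only [ordinaryHypergeometricCoefficient, ascPochhammer_succ_eval, ascPochhammer_eval_one,
    Nat.factorial_succ]
  push_cast
  have h' : (1 : ℂ) + n ≠ 0 := by rwa [add_comm]
  field_simp
  ring

theorem norm_ordinaryHypergeometricCoefficient_le {a b : ℂ} (ha : ‖a‖ ≤ 1) (hb : ‖b‖ ≤ 1) (n : ℕ) :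
    ‖ordinaryHypergeometricCoefficient a b 1 n‖ ≤ 1 := by
  induction n with
  | zero => simp
  | succ n ih =>
    have h := congrArg norm (ordinaryHypergeometricCoefficient_one_succ a b n)
    generalize ordinaryHypergeometricCoefficient a b 1 n = c at ih h
    generalize ordinaryHypergeometricCoefficient a b 1 (n + 1) = c' at h ⊢
    have e : ‖((n : ℂ) + 1)‖ = (n : ℝ) + 1 := by
      rw [← Complex.norm_of_nonneg (r := (n : ℝ) + 1) (by positivity)]
      push_cast; rfl
    rw [norm_mul, norm_mul, norm_mul, norm_pow, e] at h
    have h1 : ‖a + n‖ ≤ n + 1 := (norm_add_le _ _).trans (by rw [Complex.norm_natCast]; linarith)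
    have h2 : ‖b + n‖ ≤ n + 1 := (norm_add_le _ _).trans (by rw [Complex.norm_natCast]; linarith)
    have h3 : ((n : ℝ) + 1) ^ 2 * ‖c'‖ ≤
        ((n : ℝ) + 1) ^ 2 * 1 := by
      rw [h, sq]
      gcongr
    exact le_of_mul_le_mul_left h3 (by positivity)

theorem hypergeometric_theta_relation {c : ℕ → ℂ} {a b : ℂ} (hc : ∀ n, ‖c n‖ ≤ 1)
    (hrec : ∀ n : ℕ, ((n : ℂ) + 1) ^ 2 * c (n + 1) = (a + n) * (b + n) * c n) {z : ℂ}
    (hz : ‖z‖ < 1) :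
    (∑' n : ℕ, ((n : ℂ) * (n * c n)) * z ^ n) =
      z * ((∑' n : ℕ, ((n : ℂ) * (n * c n)) * z ^ n) +
      (a + b) * (∑' n : ℕ, (n * c n) * z ^ n) + a * b * (∑' n : ℕ, c n * z ^ n)) := by
  have hc0 : ∀ n : ℕ, ‖c n‖ ≤ (n : ℝ) ^ 0 := by simpa using hc
  have hc1 := natCast_mul_polynomial_growth hc0
  have s0 := (summable_of_polynomial_growth hc0 hz).hasSum
  have s1 := (summable_of_polynomial_growth hc1 hz).hasSum
  have s2 := (summable_of_polynomial_growth (natCast_mul_polynomial_growth hc1) hz).hasSum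
  have t1 := (((s2.add (s1.mul_left (a + b))).add (s0.mul_left (a * b))).mul_left z)
  have t2 := (hasSum_nat_add_iff' 1).2 s2
  have := t2.unique (t1.congr_fun fun n => by
    push_cast
    linear_combination z ^ (n + 1) * hrec n)
  simpa using this

theorem hypergeometric_solvesThetaODE {a b : ℂ} (ha : ‖a‖ ≤ 1) (hb : ‖b‖ ≤ 1) :
    SolvesThetaODE (fun z => (a + b) * z / (1 - z)) (fun z => a * b * z / (1 - z))
      (ordinaryHypergeometric a b 1)
      (fun z => ∑' n : ℕ, (n * ordinaryHypergeometricCoefficient a b 1 n) * z ^ n) := by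
  have e : (ordinaryHypergeometric a b 1 : ℂ → ℂ) =
      fun z => ∑' n : ℕ, ordinaryHypergeometricCoefficient a b 1 n * z ^ n := by
    rw [ordinaryHypergeometric_eq_tsum]
    simp only [smul_eq_mul]
  rw [e]
  refine solvesThetaODE_of_tsum (norm_ordinaryHypergeometricCoefficient_le ha hb) ?_
  have hD : ∀ᶠ z : ℂ in 𝓝 0, 1 - z ≠ 0 :=
    ContinuousAt.eventually_ne (by fun_prop) (by norm_num)
  filter_upwards [Metric.ball_mem_nhds (0 : ℂ) one_pos, hD] with z hz hD
  have := hypergeometric_theta_relation (norm_ordinaryHypergeometricCoefficient_le ha hb)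
    (ordinaryHypergeometricCoefficient_one_succ a b) (z := z) (by simpa using hz)
  generalize ∑' n : ℕ, ((n : ℂ) * (n * ordinaryHypergeometricCoefficient a b 1 n)) * z ^ n = A2
    at this ⊢
  generalize ∑' n : ℕ, (n * ordinaryHypergeometricCoefficient a b 1 n) * z ^ n = A1 at this ⊢
  generalize ∑' n : ℕ, ordinaryHypergeometricCoefficient a b 1 n * z ^ n = A0 at this ⊢
  field_simp
  linear_combination this

/-! ### Uniqueness at a regular singular point -/

/-- `f` solves `ϑ² f = k ϑ f + Q f` near `0` for the derivation `ϑ = τ d/dx`. -/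
structure SolvesODE (τ k Q f : ℂ → ℂ) : Prop where
  analytic : AnalyticAt ℂ f 0
  eq : ∀ᶠ x in 𝓝 0, τ x * deriv (fun y => τ y * deriv f y) x = k x * (τ x * deriv f x) + Q x * f x

/-- If `W` vanished to finite order `n > 0` at `0`, comparing leading coefficients would give `n
σ(0) = k(0) = 0`. -/
theorem eventually_eq_zero_of_mul_deriv_eq {σ k W : ℂ → ℂ} (hW : AnalyticAt ℂ W 0) (hW0 : W 0 = 0)
    (hσ : ContinuousAt σ 0) (hσ0 : σ 0 ≠ 0) (hk : ContinuousAt k 0) (hk0 : k 0 = 0)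
    (h : ∀ᶠ x in 𝓝 0, x * σ x * deriv W x = k x * W x) : ∀ᶠ x in 𝓝 0, W x = 0 := by
  by_contra hne
  obtain ⟨n, w, hw, hw0, hWw⟩ := hW.exists_eventuallyEq_pow_smul_nonzero_iff.2 hne
  simp only [sub_zero, smul_eq_mul] at hWw
  have hn : n ≠ 0 := by
    rintro rfl
    have := hWw.self_of_nhds
    rw [hW0, pow_zero, one_mul] at this
    exact hw0 this.symm
  have hw_an := hw.eventually_analyticAt
  have hev : ∀ᶠ x in 𝓝[≠] (0 : ℂ), σ x * (n * w x + x * deriv w x) = k x * w x := by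
    filter_upwards [eventually_nhdsWithin_of_eventually_nhds
      (h.and (hWw.eventually_nhds.and hw_an)), self_mem_nhdsWithin] with x ⟨h, hWw, hw⟩ hx
    have hx0 : x ≠ 0 := hx
    have hd : deriv W x = n * x ^ (n - 1) * w x + x ^ n * deriv w x := by
      rw [EventuallyEq.deriv_eq hWw]
      exact ((hasDerivAt_pow n x).mul hw.differentiableAt.hasDerivAt).deriv
    rw [hd, hWw.self_of_nhds] at h
    obtain ⟨m, rfl⟩ := Nat.exists_eq_succ_of_ne_zero hn
    rw [Nat.succ_eq_add_one, Nat.add_sub_cancel] at h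
    refine mul_left_cancel₀ (pow_ne_zero (m + 1) hx0) ?_
    rw [Nat.succ_eq_add_one]
    linear_combination h
  have hl : ContinuousAt (fun x => σ x * (n * w x + x * deriv w x)) 0 :=
    hσ.mul ((continuousAt_const.mul hw.continuousAt).add
      (continuousAt_id.mul hw.deriv.continuousAt))
  have := tendsto_nhds_unique_of_eventuallyEq (hl.tendsto.mono_left nhdsWithin_le_nhds)
    ((hk.mul hw.continuousAt).tendsto.mono_left nhdsWithin_le_nhds) hev
  simp [hk0, hσ0, hn, hw0] at this

/-- Abel's identity `ϑW = kW` for the Wronskian `W = f ϑg - g ϑf`, together with `W(0) = 0` (as `ϑ`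
carries the factor `x`), forces `W = 0`. Then `g/f` is constant. This excludes the logarithmic
second solution. -/
theorem SolvesODE.eventuallyEq {σ k Q f g : ℂ → ℂ} (hσ : AnalyticAt ℂ σ 0) (hσ0 : σ 0 ≠ 0)
    (hk : ContinuousAt k 0) (hk0 : k 0 = 0) (hf : SolvesODE (fun x => x * σ x) k Q f)
    (hg : SolvesODE (fun x => x * σ x) k Q g) (hf0 : f 0 ≠ 0) (hfg : f 0 = g 0) :
    f =ᶠ[𝓝 0] g := by
  have hF : AnalyticAt ℂ (fun x => (x * σ x) * deriv f x) 0 :=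
    (analyticAt_id.mul hσ).mul hf.analytic.deriv
  have hG : AnalyticAt ℂ (fun x => (x * σ x) * deriv g x) 0 :=
    (analyticAt_id.mul hσ).mul hg.analytic.deriv
  have hW : ∀ᶠ x in 𝓝 0,
      f x * ((x * σ x) * deriv g x) - g x * ((x * σ x) * deriv f x) = 0 := by
    refine eventually_eq_zero_of_mul_deriv_eq
      ((hf.analytic.mul hG).sub (hg.analytic.mul hF)) (by simp) hσ.continuousAt hσ0 hk hk0 ?_
    filter_upwards [hf.eq, hg.eq, hf.analytic.eventually_analyticAt,
      hg.analytic.eventually_analyticAt, hF.eventually_analyticAt, hG.eventually_analyticAt]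
      with x e1 e2 a1 a2 a3 a4
    have hd := ((a1.differentiableAt.hasDerivAt.mul a4.differentiableAt.hasDerivAt).sub
      (a2.differentiableAt.hasDerivAt.mul a3.differentiableAt.hasDerivAt)).deriv
    rw [show deriv (fun x => f x * ((x * σ x) * deriv g x) - g x * ((x * σ x) * deriv f x)) x = _
      from hd]
    linear_combination f x * e2 - g x * e1
  have hq : AnalyticAt ℂ (fun x => g x / f x) 0 := hg.analytic.div hf.analytic hf0
  have hc : ∀ᶠ x in 𝓝 0, g x / f x - 1 = 0 := by
    have hd : ∀ᶠ x in 𝓝[≠] (0 : ℂ), deriv (fun x => g x / f x) x = 0 := by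
      filter_upwards [eventually_nhdsWithin_of_eventually_nhds
        (hW.and ((hσ.continuousAt.eventually_ne hσ0).and
        ((hf.analytic.continuousAt.eventually_ne hf0).and
        (hf.analytic.eventually_analyticAt.and hg.analytic.eventually_analyticAt)))),
        self_mem_nhdsWithin] with x ⟨hW, hσ, hf0, hf, hg⟩ hx
      have hx0 : x ≠ 0 := hx
      rw [(hg.differentiableAt.hasDerivAt.fun_div hf.differentiableAt.hasDerivAt hf0).deriv]
      have : deriv g x * f x - g x * deriv f x = 0 :=
        mul_left_cancel₀ (mul_ne_zero hx0 hσ) (by linear_combination hW)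
      rw [this, zero_div]
    -- Cancelling `x σ` is possible only for `x ≠ 0`; isolation of zeros extends the vanishing to `x
    -- = 0`.
    have hd' : ∀ᶠ x in 𝓝 (0 : ℂ), deriv (fun x => g x / f x) x = 0 :=
      (hq.deriv.frequently_zero_iff_eventually_zero).1 hd.frequently
    -- The case `σ = 1`, `k = 0` says that a function with zero derivative and value `0` at the
    -- origin is zero.
    refine eventually_eq_zero_of_mul_deriv_eq (σ := fun _ => 1) (k := fun _ => 0)
      (hq.sub analyticAt_const) (by simp [← hfg, hf0]) continuousAt_const one_ne_zero
      continuousAt_const rfl ?_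
    filter_upwards [hd'] with x hx
    have : deriv (fun x => g x / f x - 1) x = 0 := by rw [deriv_sub_const, hx]
    rw [this]
    simp
  filter_upwards [hc, hf.analytic.continuousAt.eventually_ne hf0] with x hx hfx
  rw [sub_eq_zero, div_eq_one_iff_eq hfx] at hx
  exact hx.symm

/-! ### Pullback of equations and complex powers -/

/-- Pullback of a solution along `φ`, twisted by `A`, where `ϑ A = l₀ A`, `ϑ φ = l φ`. -/
theorem SolvesThetaODE.pullback {p q h h₁ : ℂ → ℂ} (hh : SolvesThetaODE p q h h₁)
    {τ k Q A φ l l₀ : ℂ → ℂ} (hA : AnalyticAt ℂ A 0)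
    (hφ : AnalyticAt ℂ φ 0) (hφ0 : φ 0 = 0)
    (hl : AnalyticAt ℂ l 0) (hl₀ : AnalyticAt ℂ l₀ 0)
    (hAeq : ∀ᶠ x in 𝓝 0, τ x * deriv A x = l₀ x * A x)
    (hφeq : ∀ᶠ x in 𝓝 0, τ x * deriv φ x = l x * φ x)
    (h1 : ∀ᶠ x in 𝓝 0, τ x * deriv l x + l x ^ 2 * p (φ x) + 2 * l₀ x * l x = k x * l x)
    (h2 : ∀ᶠ x in 𝓝 0,
      τ x * deriv l₀ x - l₀ x * (k x - l₀ x) + l x ^ 2 * q (φ x) = Q x) :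
    SolvesODE τ k Q (fun x => A x * h (φ x)) := by
  have han : AnalyticAt ℂ h (φ 0) := by rw [hφ0]; exact hh.analytic
  have han1 : AnalyticAt ℂ h₁ (φ 0) := by rw [hφ0]; exact hh.analytic_theta
  have hφt : Tendsto φ (𝓝 0) (𝓝 0) := by simpa [ContinuousAt, hφ0] using hφ.continuousAt
  refine ⟨hA.mul (han.comp hφ), ?_⟩
  have hfirst : ∀ᶠ x in 𝓝 0, τ x * deriv (fun x => A x * h (φ x)) x =
      l₀ x * (A x * h (φ x)) + l x * (A x * h₁ (φ x)) := by
    filter_upwards [hA.eventually_analyticAt, hφ.eventually_analyticAt,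
      hφt.eventually hh.analytic.eventually_analyticAt, hAeq, hφeq, hφt.eventually hh.theta_eq]
      with x a1 a2 a3 e1 e2 e3
    have hd := (a1.differentiableAt.hasDerivAt.mul (a3.differentiableAt.hasDerivAt.comp x
      a2.differentiableAt.hasDerivAt)).deriv
    rw [show deriv (fun x => A x * h (φ x)) x = _ from hd]
    simp only [Function.comp_apply]
    linear_combination h (φ x) * e1 + A x * deriv h (φ x) * e2 + A x * l x * e3
  filter_upwards [hA.eventually_analyticAt, hφ.eventually_analyticAt, hl.eventually_analyticAt,
      hl₀.eventually_analyticAt, hφt.eventually hh.analytic.eventually_analyticAt,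
      hφt.eventually hh.analytic_theta.eventually_analyticAt, hAeq, hφeq,
      hφt.eventually hh.theta_eq, hφt.eventually hh.theta_theta_eq, h1, h2,
      hfirst.eventually_nhds] with x a1 a2 a3 a4 a5 a6 e1 e2 e3 e4 h1 h2 hf
  rw [hf.self_of_nhds, EventuallyEq.deriv_eq hf]
  have d1 := a1.differentiableAt.hasDerivAt
  have d2 := a2.differentiableAt.hasDerivAt
  have hd := ((a4.differentiableAt.hasDerivAt.mul (d1.mul
      (a5.differentiableAt.hasDerivAt.comp x d2))).add
      (a3.differentiableAt.hasDerivAt.mul (d1.mul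
      (a6.differentiableAt.hasDerivAt.comp x d2)))).deriv
  rw [show deriv (fun x => l₀ x * (A x * h (φ x)) + l x * (A x * h₁ (φ x))) x = _ from hd]
  simp only [Pi.mul_apply, Function.comp_apply]
  -- The last two terms match the coefficients of `A h₁(φ)` and `A h(φ)`; the others are the chain
  -- rule and the equation of `h`.
  linear_combination (l₀ x * h (φ x) + l x * h₁ (φ x)) * e1 +
    (l₀ x * A x * deriv h (φ x) + l x * A x * deriv h₁ (φ x)) * e2 +
    l₀ x * A x * l x * e3 + l x ^ 2 * A x * e4 + A x * h₁ (φ x) * h1 + A x * h (φ x) * h2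

theorem AnalyticAt.cpow_const {f : ℂ → ℂ} {x : ℂ} (hf : AnalyticAt ℂ f x)
    (hx : f x ∈ Complex.slitPlane) (a : ℂ) : AnalyticAt ℂ (fun y => f y ^ a) x :=
  hf.cpow analyticAt_const hx

theorem deriv_const_cpow_of_mul_deriv_eq {f : ℂ → ℂ} {x τ l a : ℂ} (hf : DifferentiableAt ℂ f x)
    (hx : f x ∈ Complex.slitPlane) (h : τ * deriv f x = l * f x) :
    τ * deriv (fun y => f y ^ a) x = a * l * f x ^ a := by
  have h0 : f x ≠ 0 := Complex.slitPlane_ne_zero hx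
  rw [(hf.hasDerivAt.cpow_const hx).deriv, Complex.cpow_sub _ _ h0, Complex.cpow_one]
  field_simp
  linear_combination a * f x ^ a * h

/-! ### The hypergeometric form of `h7` -/

theorem h7_solvesODE :
    SolvesODE (fun x => x * 1) (fun z => -(2 / 3) * (2 * z ^ 2 + 13 * z) / (z ^ 2 + 13 * z + 49))
      (fun z => -(4 * z ^ 2 + 21 * z) / (9 * (z ^ 2 + 13 * z + 49))) (fun x => 1 * h7 x) := by
  refine h7_solvesThetaODE.pullback (A := fun _ => 1) (φ := fun x => x) (l := fun _ => 1)
    (l₀ := fun _ => 0) analyticAt_const analyticAt_id rfl analyticAt_const analyticAt_const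
    ?_ ?_ ?_ ?_ <;> refine Eventually.of_forall fun x => ?_ <;> simp

/-- With `φ` the hypergeometric argument and `H` the quartic squared here, this gives `φ/(1-φ) =
1728z/H²`. Since `ϑφ/φ` has `H` in its numerator, the pole at `φ = 1` cancels in `l²`. -/
theorem septic_discriminant (z : ℂ) :
    (z ^ 2 + 5 * z + 1) ^ 3 * (z ^ 2 + 13 * z + 49) - 1728 * z =
      (z ^ 4 + 14 * z ^ 3 + 63 * z ^ 2 + 70 * z - 7) ^ 2 := by
  ring

theorem hasDerivAt_septic_factors (z : ℂ) :
    HasDerivAt (fun z : ℂ => z ^ 2 + 5 * z + 1) (2 * z + 5) z ∧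
    HasDerivAt (fun z : ℂ => z ^ 2 + 13 * z + 49) (2 * z + 13) z ∧
    HasDerivAt (fun z : ℂ => z ^ 4 + 14 * z ^ 3 + 63 * z ^ 2 + 70 * z - 7)
      (4 * z ^ 3 + 42 * z ^ 2 + 126 * z + 70) z := by
  have h1 := hasDerivAt_id' z
  refine ⟨?_, ?_, ?_⟩
  · refine (((h1.pow 2).add (h1.const_mul 5)).add_const 1).congr_deriv ?_
    push_cast; ring
  · refine (((h1.pow 2).add (h1.const_mul 13)).add_const 49).congr_deriv ?_
    push_cast; ring
  · refine (((((h1.pow 4).add ((h1.pow 3).const_mul 14)).add ((h1.pow 2).const_mul 63)).add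
      (h1.const_mul 70)).sub_const 7).congr_deriv ?_
    push_cast; ring

theorem hypergeometric_pullback_solvesODE :
    SolvesODE (fun x => x * 1) (fun z => -(2 / 3) * (2 * z ^ 2 + 13 * z) / (z ^ 2 + 13 * z + 49))
      (fun z => -(4 * z ^ 2 + 21 * z) / (9 * (z ^ 2 + 13 * z + 49)))
      (fun z => (1 / 49 * (z ^ 2 + 5 * z + 1) ^ 3 * (z ^ 2 + 13 * z + 49)) ^ (-(1 / 12) : ℂ) *
        ordinaryHypergeometric (1 / 12 : ℂ) (5 / 12 : ℂ) (1 : ℂ)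
          (1728 * z / ((z ^ 2 + 5 * z + 1) ^ 3 * (z ^ 2 + 13 * z + 49)))) := by
  have hE : (∀ᶠ z : ℂ in 𝓝 0, z ^ 2 + 5 * z + 1 ≠ 0) ∧ (∀ᶠ z : ℂ in 𝓝 0, z ^ 2 + 13 * z + 49 ≠ 0) ∧
      (∀ᶠ z : ℂ in 𝓝 0, z ^ 4 + 14 * z ^ 3 + 63 * z ^ 2 + 70 * z - 7 ≠ 0) := by
    refine ⟨?_, ?_, ?_⟩ <;> exact ContinuousAt.eventually_ne (by fun_prop) (by norm_num)
  obtain ⟨he, hD, hH⟩ := hE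
  have hEan : AnalyticAt ℂ
      (fun z : ℂ => 1 / 49 * (z ^ 2 + 5 * z + 1) ^ 3 * (z ^ 2 + 13 * z + 49)) 0 := by fun_prop
  have hslit0 : (1 / 49 * ((0 : ℂ) ^ 2 + 5 * 0 + 1) ^ 3 * ((0 : ℂ) ^ 2 + 13 * 0 + 49)) ∈
      Complex.slitPlane := by norm_num
  have hslit : ∀ᶠ z : ℂ in 𝓝 0, 1 / 49 * (z ^ 2 + 5 * z + 1) ^ 3 * (z ^ 2 + 13 * z + 49) ∈
      Complex.slitPlane :=
    hEan.continuousAt.eventually_mem (Complex.isOpen_slitPlane.mem_nhds hslit0)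
  have h2 : ∀ z : ℂ, HasDerivAt (fun z : ℂ => 6 * z ^ 2 + 15 * z) (12 * z + 15) z := fun z =>
    ((((hasDerivAt_id' z).fun_pow 2).const_mul 6).add ((hasDerivAt_id' z).const_mul 15)).congr_deriv
      (by push_cast; ring)
  have h3 : ∀ z : ℂ, HasDerivAt (fun z : ℂ => 2 * z ^ 2 + 13 * z) (4 * z + 13) z := fun z =>
    ((((hasDerivAt_id' z).fun_pow 2).const_mul 2).add ((hasDerivAt_id' z).const_mul 13)).congr_deriv
      (by push_cast; ring)
  have hφ : ∀ z : ℂ, z ^ 2 + 5 * z + 1 ≠ 0 → z ^ 2 + 13 * z + 49 ≠ 0 →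
      z ^ 4 + 14 * z ^ 3 + 63 * z ^ 2 + 70 * z - 7 ≠ 0 →
      1728 * z / ((z ^ 2 + 5 * z + 1) ^ 3 * (z ^ 2 + 13 * z + 49)) /
        (1 - 1728 * z / ((z ^ 2 + 5 * z + 1) ^ 3 * (z ^ 2 + 13 * z + 49))) =
      1728 * z / (z ^ 4 + 14 * z ^ 3 + 63 * z ^ 2 + 70 * z - 7) ^ 2 := by
    intro z he hD hH
    have hP := mul_ne_zero (pow_ne_zero 3 he) hD
    rw [one_sub_div hP, septic_discriminant, div_div_div_cancel_right₀ hP]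
  refine (hypergeometric_solvesThetaODE (a := 1 / 12) (b := 5 / 12) (by norm_num)
    (by norm_num)).pullback
    (A := fun z => (1 / 49 * (z ^ 2 + 5 * z + 1) ^ 3 * (z ^ 2 + 13 * z + 49)) ^ (-(1 / 12) : ℂ))
    (φ := fun z => 1728 * z / ((z ^ 2 + 5 * z + 1) ^ 3 * (z ^ 2 + 13 * z + 49)))
    (l := fun z => -7 * (z ^ 4 + 14 * z ^ 3 + 63 * z ^ 2 + 70 * z - 7) /
      ((z ^ 2 + 5 * z + 1) * (z ^ 2 + 13 * z + 49)))
    (l₀ := fun z => -(1 / 12) * ((6 * z ^ 2 + 15 * z) / (z ^ 2 + 5 * z + 1) +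
      (2 * z ^ 2 + 13 * z) / (z ^ 2 + 13 * z + 49)))
    (hEan.cpow_const hslit0 _) ?_ (by simp) ?_ ?_ ?_ ?_ ?_ ?_
  · exact (by fun_prop : AnalyticAt ℂ (fun z : ℂ => 1728 * z) 0).fun_div (by fun_prop) (by norm_num)
  · exact (by fun_prop : AnalyticAt ℂ (fun z : ℂ => -7 * (z ^ 4 + 14 * z ^ 3 + 63 * z ^ 2 + 70 * z - 7))
      0).fun_div (by fun_prop) (by norm_num)
  · exact analyticAt_const.fun_mul
      (((by fun_prop : AnalyticAt ℂ (fun z : ℂ => 6 * z ^ 2 + 15 * z) 0).fun_div (by fun_prop)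
        (by norm_num)).fun_add
      ((by fun_prop : AnalyticAt ℂ (fun z : ℂ => 2 * z ^ 2 + 13 * z) 0).fun_div (by fun_prop)
        (by norm_num)))
  · filter_upwards [he, hD, hslit] with z he hD hslit
    obtain ⟨d1, d2, d3⟩ := hasDerivAt_septic_factors z
    refine deriv_const_cpow_of_mul_deriv_eq (by fun_prop) hslit (l := (6 * z ^ 2 + 15 * z) /
      (z ^ 2 + 5 * z + 1) + (2 * z ^ 2 + 13 * z) / (z ^ 2 + 13 * z + 49)) ?_
    rw [(((d1.fun_pow 3).const_mul (1 / 49)).fun_mul d2).deriv]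
    generalize hs : z ^ 2 + 5 * z + 1 = s at he ⊢
    generalize hs' : z ^ 2 + 13 * z + 49 = s' at hD ⊢
    field_simp
    push_cast
    ring
  · filter_upwards [he, hD] with z he hD
    obtain ⟨d1, d2, d3⟩ := hasDerivAt_septic_factors z
    rw [(((hasDerivAt_id' z).const_mul 1728).fun_div ((d1.fun_pow 3).fun_mul d2)
      (mul_ne_zero (pow_ne_zero 3 he) hD)).deriv]
    generalize hs : z ^ 2 + 5 * z + 1 = s at he ⊢
    generalize hs' : z ^ 2 + 13 * z + 49 = s' at hD ⊢
    field_simp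
    push_cast
    rw [← hs, ← hs']
    ring
  · filter_upwards [he, hD, hH] with z he hD hH
    obtain ⟨d1, d2, d3⟩ := hasDerivAt_septic_factors z
    rw [((d3.const_mul (-7)).fun_div (d1.fun_mul d2) (mul_ne_zero he hD)).deriv]
    rw [mul_div_assoc (1 / 12 + 5 / 12 : ℂ), hφ z he hD hH]
    generalize hs : z ^ 2 + 5 * z + 1 = s at he ⊢
    generalize hs' : z ^ 2 + 13 * z + 49 = s' at hD ⊢
    generalize hh : z ^ 4 + 14 * z ^ 3 + 63 * z ^ 2 + 70 * z - 7 = w at hH ⊢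
    field_simp
    rw [← hs, ← hs', ← hh]
    ring
  · filter_upwards [he, hD, hH] with z he hD hH
    obtain ⟨d1, d2, d3⟩ := hasDerivAt_septic_factors z
    have d4 := (((h2 z).fun_div d1 he).fun_add ((h3 z).fun_div d2 hD)).const_mul (-(1 / 12) : ℂ)
    rw [d4.deriv, mul_div_assoc (1 / 12 * (5 / 12) : ℂ), hφ z he hD hH]
    generalize hs : z ^ 2 + 5 * z + 1 = s at he ⊢
    generalize hs' : z ^ 2 + 13 * z + 49 = s' at hD ⊢
    generalize hh : z ^ 4 + 14 * z ^ 3 + 63 * z ^ 2 + 70 * z - 7 = w at hH ⊢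
    field_simp
    rw [← hs, ← hs']
    ring

theorem h7_eventuallyEq_hypergeometric :
    ∀ᶠ z : ℂ in 𝓝 0,
      h7 z = (1 / 49 * (z ^ 2 + 5 * z + 1) ^ 3 * (z ^ 2 + 13 * z + 49)) ^ (-(1 / 12) : ℂ) *
        ordinaryHypergeometric (1 / 12 : ℂ) (5 / 12 : ℂ) (1 : ℂ)
          (1728 * z / ((z ^ 2 + 5 * z + 1) ^ 3 * (z ^ 2 + 13 * z + 49))) := by
  have h := h7_solvesODE.eventuallyEq (σ := fun _ => 1) analyticAt_const one_ne_zero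
    ?_ (by norm_num) hypergeometric_pullback_solvesODE (by simp [h7_zero]) ?_
  · filter_upwards [h] with z hz
    simpa using hz
  · exact ContinuousAt.div (by fun_prop) (by fun_prop) (by norm_num)
  · norm_num [h7_zero]

/-! ### Polynomial identities modulo the quadratic relation for `g` -/

section SepticAlgebra

variable {x g : ℂ}

theorem septic_left_quadratic (hg : x ^ 4 * g ^ 2 - (1 - 7 * x + 7 * x ^ 2) * g + 7 = 0) :
    (x * (1 - 7 * x + 14 * x ^ 2 - 7 * x ^ 3) * g ^ 2) ^ 2 +
      13 * (x * (1 - 7 * x + 14 * x ^ 2 - 7 * x ^ 3) * g ^ 2) + 49 =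
    (1 - x) * g ^ 2 * (1 + (1 - 2 * x) * x ^ 2 * g) ^ 3 := by
  linear_combination (7 + (1 - 7 * x + 7 * x ^ 2) * g + (-4 * x ^ 2 + 12 * x ^ 3 - 7 * x ^ 4) * g ^ 2
    + (-x ^ 2 + 7 * x ^ 3 - 18 * x ^ 4 + 20 * x ^ 5 - 8 * x ^ 6) * g ^ 3) * hg

theorem septic_right_quadratic (hg : x ^ 4 * g ^ 2 - (1 - 7 * x + 7 * x ^ 2) * g + 7 = 0)
    (hg0 : g ≠ 0) (hρ : 1 - 7 * x + 14 * x ^ 2 - 7 * x ^ 3 ≠ 0) :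
    (x ^ 7 * g ^ 2 / (1 - 7 * x + 14 * x ^ 2 - 7 * x ^ 3)) ^ 2 +
      13 * (x ^ 7 * g ^ 2 / (1 - 7 * x + 14 * x ^ 2 - 7 * x ^ 3)) + 49 =
    (1 - x) * (7 * (1 - 2 * x) + x ^ 2 * g) ^ 3 / ((1 - 7 * x + 14 * x ^ 2 - 7 * x ^ 3) ^ 2 * g) := by
  generalize hs : 1 - 7 * x + 14 * x ^ 2 - 7 * x ^ 3 = ρ at hρ ⊢
  rw [eq_div_iff (by positivity)]
  field_simp
  rw [← hs]
  linear_combination (-49 + 343 * x - 882 * x ^ 2 + 980 * x ^ 3 - 392 * x ^ 4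
    + (-28 * x ^ 4 + 84 * x ^ 5 - 49 * x ^ 6) * g + (x ^ 6 - 7 * x ^ 7 + 7 * x ^ 8) * g ^ 2
    + x ^ 10 * g ^ 3) * hg

/-- This is `ϑz/z = 7b²/(gρ)` for `z = xρg²`, denominators cleared, using `ϑg/g = x(7 - 14x +
4x³g)`. -/
theorem septic_left_logDeriv (hg : x ^ 4 * g ^ 2 - (1 - 7 * x + 7 * x ^ 2) * g + 7 = 0) :
    ((1 - 7 * x + 7 * x ^ 2 - 2 * x ^ 4 * g) * (1 - 7 * x + 14 * x ^ 2 - 7 * x ^ 3)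
      + x * (1 - 7 * x + 7 * x ^ 2 - 2 * x ^ 4 * g) * (-7 + 28 * x - 21 * x ^ 2)
      + 2 * x * (7 - 14 * x + 4 * x ^ 3 * g) * (1 - 7 * x + 14 * x ^ 2 - 7 * x ^ 3)) * g =
    7 * (1 + (1 - 2 * x) * x ^ 2 * g) ^ 2 := by
  linear_combination -hg

theorem septic_right_logDeriv (hg : x ^ 4 * g ^ 2 - (1 - 7 * x + 7 * x ^ 2) * g + 7 = 0) :
    (7 * (1 - 7 * x + 7 * x ^ 2 - 2 * x ^ 4 * g) * (1 - 7 * x + 14 * x ^ 2 - 7 * x ^ 3)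
      - x * (1 - 7 * x + 7 * x ^ 2 - 2 * x ^ 4 * g) * (-7 + 28 * x - 21 * x ^ 2)
      + 2 * x * (7 - 14 * x + 4 * x ^ 3 * g) * (1 - 7 * x + 14 * x ^ 2 - 7 * x ^ 3)) * g =
    (7 * (1 - 2 * x) + x ^ 2 * g) ^ 2 := by
  linear_combination (-7 + 28 * x - 28 * x ^ 2) * hg

/-- Two computations of `ϑ(z² + 13z + 49)`, by the chain rule and from its factorization, with the
common factor `b²` removed. It turns `l p(z)` into `-(2/3)` times the logarithmic derivative of
`(1-x)g²b³`. -/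
theorem septic_left_theta_quadratic (hg : x ^ 4 * g ^ 2 - (1 - 7 * x + 7 * x ^ 2) * g + 7 = 0) :
    7 * x * g * (2 * (x * (1 - 7 * x + 14 * x ^ 2 - 7 * x ^ 3) * g ^ 2) + 13) =
    g ^ 2 * (-x * (1 - 7 * x + 7 * x ^ 2 - 2 * x ^ 4 * g) * (1 + (1 - 2 * x) * x ^ 2 * g) +
      (1 - x) * (2 * (1 + (1 - 2 * x) * x ^ 2 * g) * (x * (7 - 14 * x + 4 * x ^ 3 * g)) +
      3 * ((2 * x - 6 * x ^ 2) * x * (1 - 7 * x + 7 * x ^ 2 - 2 * x ^ 4 * g) * g +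
        (1 - 2 * x) * x ^ 2 * g * (x * (7 - 14 * x + 4 * x ^ 3 * g))))) := by
  linear_combination (13 * x * g + (-8 * x ^ 2 + 10 * x ^ 3) * g ^ 2) * hg

/-- The same comparison for `z'` and `(1-x)c³/(ρ²g)`, with `c²` removed and denominators cleared. -/
theorem septic_right_theta_quadratic (hg : x ^ 4 * g ^ 2 - (1 - 7 * x + 7 * x ^ 2) * g + 7 = 0) :
    x ^ 7 * g ^ 2 * (2 * x ^ 7 * g ^ 2 + 13 * (1 - 7 * x + 14 * x ^ 2 - 7 * x ^ 3)) =
    (1 - 7 * x + 14 * x ^ 2 - 7 * x ^ 3) *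
      (-x * (1 - 7 * x + 7 * x ^ 2 - 2 * x ^ 4 * g) * (7 * (1 - 2 * x) + x ^ 2 * g) +
      3 * (1 - x) * (-14 * x * (1 - 7 * x + 7 * x ^ 2 - 2 * x ^ 4 * g) +
        2 * x ^ 2 * (1 - 7 * x + 7 * x ^ 2 - 2 * x ^ 4 * g) * g +
        x ^ 2 * g * (x * (7 - 14 * x + 4 * x ^ 3 * g))) -
      (1 - x) * (7 * (1 - 2 * x) + x ^ 2 * g) * (x * (7 - 14 * x + 4 * x ^ 3 * g))) -
    2 * (1 - x) * (7 * (1 - 2 * x) + x ^ 2 * g) *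
      (x * (1 - 7 * x + 7 * x ^ 2 - 2 * x ^ 4 * g) * (-7 + 28 * x - 21 * x ^ 2)) := by
  linear_combination (6 * x ^ 2 - 21 * x ^ 3 - 7 * x ^ 4 + 70 * x ^ 5 - 49 * x ^ 6 +
    (2 * x ^ 6 - 14 * x ^ 7 + 14 * x ^ 8) * g + 2 * x ^ 10 * g ^ 2) * hg

/-- The compatibility of the two zeroth-order coefficients, with denominators cleared. -/
theorem septic_zeroth_identity (hg : x ^ 4 * g ^ 2 - (1 - 7 * x + 7 * x ^ 2) * g + 7 = 0)
    {S T θS θT Γ θΓ ρ b c k l : ℂ}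
    (hρ : ρ = 1 - 7 * x + 14 * x ^ 2 - 7 * x ^ 3) (hb : b = 1 + (1 - 2 * x) * x ^ 2 * g)
    (hc : c = 7 * (1 - 2 * x) + x ^ 2 * g)
    (hS : S = 1 - 7 * x + 7 * x ^ 2 - 2 * x ^ 4 * g) (hΓ : Γ = x * (7 - 14 * x + 4 * x ^ 3 * g))
    (hθS : θS = x * S * (-7 + 14 * x - 8 * x ^ 3 * g) - 2 * x ^ 4 * g * Γ)
    (hθΓ : θΓ = x * S * (7 - 28 * x + 16 * x ^ 3 * g) + 4 * x ^ 4 * g * Γ)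
    (hT : T = x * S * (-7 + 28 * x - 21 * x ^ 2))
    (hθT : θT = x * S * S * (-7 + 28 * x - 21 * x ^ 2) + x * θS * (-7 + 28 * x - 21 * x ^ 2) +
      x * S * (x * S) * (28 - 42 * x))
    (hl : l = -(2 / 3) * T - Γ * ρ)
    (hk : k = (-(7 / 3) * Γ * ρ - T) * (1 - x) + 2 / 3 * x * S * ρ) :
    9 * g ^ 2 * ((1 - x) * (-(2 / 3) * (θT * ρ - T ^ 2) - θΓ * ρ ^ 2) - l * (k - (1 - x) * l)) -
      g ^ 3 * (4 * x ^ 7 * g ^ 2 + 21 * ρ) * x ^ 7 * c +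
      49 * x * (4 * x * ρ * g ^ 2 + 21) * b * ρ = 0 := by
  subst hl hk hθT hT hθΓ hθS hΓ hS hρ hb hc
  linear_combination (147 * x - 1029 * x ^ 2 + 2058 * x ^ 3 - 1029 * x ^ 4 +
    (21 * x - 294 * x ^ 2 + 1617 * x ^ 3 - 4557 * x ^ 4 + 7203 * x ^ 5 - 6174 * x ^ 6
      + 2058 * x ^ 7) * g +
    (-52 * x ^ 4 + 595 * x ^ 5 - 2485 * x ^ 6 + 4718 * x ^ 7 - 3969 * x ^ 8 + 1176 * x ^ 9) * g ^ 2 +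
    (-4 * x ^ 8 + 28 * x ^ 9 - 56 * x ^ 10 + 56 * x ^ 11) * g ^ 3 - 4 * x ^ 12 * g ^ 4) * hg

end SepticAlgebra

/-! ### The algebraic function `g` -/

theorem exists_septic_unit : ∃ g : ℂ → ℂ, AnalyticAt ℂ g 0 ∧ g 0 = 7 ∧
    ∀ᶠ x in 𝓝 0, x ^ 4 * g x ^ 2 - (1 - 7 * x + 7 * x ^ 2) * g x + 7 = 0 := by
  have hs0 : ((1 - 7 * (0 : ℂ) + 7 * 0 ^ 2) ^ 2 - 28 * 0 ^ 4) ∈ Complex.slitPlane := by norm_num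
  have hS : AnalyticAt ℂ
      (fun x : ℂ => ((1 - 7 * x + 7 * x ^ 2) ^ 2 - 28 * x ^ 4) ^ (1 / 2 : ℂ)) 0 :=
    AnalyticAt.cpow_const (f := fun x : ℂ => (1 - 7 * x + 7 * x ^ 2) ^ 2 - 28 * x ^ 4)
      (by fun_prop) hs0 _
  have hr : AnalyticAt ℂ (fun x : ℂ => 1 - 7 * x + 7 * x ^ 2 +
      ((1 - 7 * x + 7 * x ^ 2) ^ 2 - 28 * x ^ 4) ^ (1 / 2 : ℂ)) 0 :=
    (by fun_prop : AnalyticAt ℂ (fun x : ℂ => 1 - 7 * x + 7 * x ^ 2) 0).fun_add hS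
  have hr0 : 1 - 7 * (0 : ℂ) + 7 * 0 ^ 2 +
      ((1 - 7 * (0 : ℂ) + 7 * 0 ^ 2) ^ 2 - 28 * 0 ^ 4) ^ (1 / 2 : ℂ) ≠ 0 := by norm_num
  -- The root `(r - √(r² - 28x⁴))/(2x⁴)` multiplied by its conjugate is `14/(r + √(r² - 28x⁴))`,
  -- which is regular at `0`.
  refine ⟨_, (analyticAt_const (v := (14 : ℂ))).fun_div hr hr0, by norm_num, ?_⟩
  filter_upwards [hr.continuousAt.eventually_ne hr0] with x hx
  have hsq : (((1 - 7 * x + 7 * x ^ 2) ^ 2 - 28 * x ^ 4) ^ (1 / 2 : ℂ)) ^ 2 =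
      (1 - 7 * x + 7 * x ^ 2) ^ 2 - 28 * x ^ 4 := by
    rw [← Complex.cpow_mul_nat]; norm_num
  generalize ((1 - 7 * x + 7 * x ^ 2) ^ 2 - 28 * x ^ 4) ^ (1 / 2 : ℂ) = S at hx hsq ⊢
  generalize 1 - 7 * x + 7 * x ^ 2 = r at hx hsq ⊢
  field_simp
  linear_combination 7 * hsq

/-- Implicit differentiation of the quadratic. The factor `S` is the reason for the derivation `ϑ =
xS d/dx`: it keeps `ϑg` polynomial in `x` and `g`. -/
theorem septic_unit_deriv {g : ℂ → ℂ} (hg : AnalyticAt ℂ g 0)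
    (hrel : ∀ᶠ x in 𝓝 0, x ^ 4 * g x ^ 2 - (1 - 7 * x + 7 * x ^ 2) * g x + 7 = 0) :
    ∀ᶠ x in 𝓝 0, (1 - 7 * x + 7 * x ^ 2 - 2 * x ^ 4 * g x) * deriv g x =
      g x * (7 - 14 * x + 4 * x ^ 3 * g x) := by
  filter_upwards [hrel.eventually_nhds, hg.eventually_analyticAt] with x h ha
  have d := ha.differentiableAt.hasDerivAt
  have d0 := hasDerivAt_id' x
  have hd := ((((d0.fun_pow 4).fun_mul (d.fun_pow 2)).fun_sub ((((d0.const_mul 7).const_sub 1).fun_add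
    ((d0.fun_pow 2).const_mul 7)).fun_mul d)).add_const 7).deriv
  have h0 : deriv (fun x => x ^ 4 * g x ^ 2 - (1 - 7 * x + 7 * x ^ 2) * g x + 7) x = 0 := by
    rw [EventuallyEq.deriv_eq (f := fun _ => (0 : ℂ)) h, deriv_const]
  rw [hd] at h0
  push_cast at h0
  linear_combination -h0

/-! ### The common differential equation of the two sides -/

section SepticODE

variable {g : ℂ → ℂ}

/-- The coefficient of `ϑ f` in the equation satisfied by both sides of the septic relation. -/
noncomputable def septicFirst (g : ℂ → ℂ) (x : ℂ) : ℂ :=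
  -(7 / 3) * (x * (7 - 14 * x + 4 * x ^ 3 * g x)) -
    x * (1 - 7 * x + 7 * x ^ 2 - 2 * x ^ 4 * g x) * (-7 + 28 * x - 21 * x ^ 2) /
      (1 - 7 * x + 14 * x ^ 2 - 7 * x ^ 3) +
    2 / 3 * (x * (1 - 7 * x + 7 * x ^ 2 - 2 * x ^ 4 * g x)) / (1 - x)

/-- The coefficient of `f` in the equation satisfied by both sides of the septic relation. -/
noncomputable def septicZeroth (g : ℂ → ℂ) (x : ℂ) : ℂ :=
  -(49 * x * (4 * (x * (1 - 7 * x + 14 * x ^ 2 - 7 * x ^ 3) * g x ^ 2) + 21) *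
    (1 + (1 - 2 * x) * x ^ 2 * g x)) /
      (9 * (1 - x) * (1 - 7 * x + 14 * x ^ 2 - 7 * x ^ 3) * g x ^ 2)

theorem eventually_septic_ne (hg : AnalyticAt ℂ g 0) (hg0 : g 0 = 7) :
    ∀ᶠ x in 𝓝 0, g x ≠ 0 ∧ 1 - 7 * x + 14 * x ^ 2 - 7 * x ^ 3 ≠ 0 ∧ 1 - x ≠ 0 ∧
      1 + (1 - 2 * x) * x ^ 2 * g x ≠ 0 ∧ 7 * (1 - 2 * x) + x ^ 2 * g x ≠ 0 := by
  have hc := hg.continuousAt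
  refine (hc.eventually_ne (by simp [hg0])).and (.and ?_ (.and ?_ (.and ?_ ?_)))
  all_goals exact ContinuousAt.eventually_ne (by fun_prop) (by norm_num)

theorem hasDerivAt_septic_cubic (x : ℂ) :
    HasDerivAt (fun x : ℂ => 1 - 7 * x + 14 * x ^ 2 - 7 * x ^ 3) (-7 + 28 * x - 21 * x ^ 2) x := by
  have d0 := hasDerivAt_id' x
  refine (((d0.const_mul 7).const_sub 1).fun_add ((d0.fun_pow 2).const_mul 14)).fun_sub
    ((d0.fun_pow 3).const_mul 7) |>.congr_deriv ?_
  push_cast; ring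

theorem hasDerivAt_septic_left_root {x G : ℂ} (d : HasDerivAt g G x) :
    HasDerivAt (fun x => 1 + (1 - 2 * x) * x ^ 2 * g x)
      ((2 * x - 6 * x ^ 2) * g x + (1 - 2 * x) * x ^ 2 * G) x := by
  have d0 := hasDerivAt_id' x
  refine ((((d0.const_mul 2).const_sub 1).fun_mul (d0.fun_pow 2)).fun_mul d).const_add 1
    |>.congr_deriv ?_
  push_cast; ring

theorem hasDerivAt_septic_right_root {x G : ℂ} (d : HasDerivAt g G x) :
    HasDerivAt (fun x => 7 * (1 - 2 * x) + x ^ 2 * g x) (-14 + 2 * x * g x + x ^ 2 * G) x := by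
  have d0 := hasDerivAt_id' x
  refine (((d0.const_mul 2).const_sub 1).const_mul 7).fun_add ((d0.fun_pow 2).fun_mul d)
    |>.congr_deriv ?_
  push_cast; ring

/-- The first-order coefficient is `ϑ log(l (z² + 13z + 49)^(-2/3))`. The powers of `b` cancel,
leaving the logarithmic derivative of `(1-x)^(-2/3) ρ⁻¹ g^(-7/3)`, which is `septicFirst`. As `A =
1`, the zeroth coefficient is just `l² q(z)`. -/
theorem septic_left_solvesODE (hg : AnalyticAt ℂ g 0) (hg0 : g 0 = 7)
    (hrel : ∀ᶠ x in 𝓝 0, x ^ 4 * g x ^ 2 - (1 - 7 * x + 7 * x ^ 2) * g x + 7 = 0) :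
    SolvesODE (fun x => x * (1 - 7 * x + 7 * x ^ 2 - 2 * x ^ 4 * g x)) (septicFirst g)
      (septicZeroth g)
      (fun x => 1 * h7 (x * (1 - 7 * x + 14 * x ^ 2 - 7 * x ^ 3) * g x ^ 2)) := by
  have hne := eventually_septic_ne hg hg0
  have hG := septic_unit_deriv hg hrel
  refine h7_solvesThetaODE.pullback (A := fun _ => 1)
    (φ := fun x => x * (1 - 7 * x + 14 * x ^ 2 - 7 * x ^ 3) * g x ^ 2)
    (l := fun x => 7 * (1 + (1 - 2 * x) * x ^ 2 * g x) ^ 2 /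
      (g x * (1 - 7 * x + 14 * x ^ 2 - 7 * x ^ 3)))
    (l₀ := fun _ => 0) analyticAt_const (by fun_prop) (by simp)
    (AnalyticAt.fun_div (by fun_prop) (by fun_prop) (by simp [hg0])) analyticAt_const
    (.of_forall fun x => by simp) ?_ ?_ ?_
  · filter_upwards [hne, hG, hrel, hg.eventually_analyticAt] with x ⟨h1, h2, h3, h4, h5⟩ hG hr ha
    have d := ha.differentiableAt.hasDerivAt
    rw [(((hasDerivAt_id' x).fun_mul (hasDerivAt_septic_cubic x)).fun_mul (d.fun_pow 2)).deriv]
    have hL := septic_left_logDeriv hr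
    generalize hρ : 1 - 7 * x + 14 * x ^ 2 - 7 * x ^ 3 = ρ at h2 hL ⊢
    have e : ∀ b : ℂ, 7 * b ^ 2 / (g x * ρ) * (x * ρ * g x ^ 2) = 7 * b ^ 2 * (x * g x) := by
      intro b
      field_simp
    rw [e]
    push_cast
    linear_combination x * g x * hL + 2 * x ^ 2 * ρ * g x * hG
  · filter_upwards [hne, hG, hrel, hg.eventually_analyticAt] with x ⟨h1, h2, h3, h4, h5⟩ hG hr ha
    have d := ha.differentiableAt.hasDerivAt
    rw [(((hasDerivAt_septic_left_root d).fun_pow 2).const_mul 7 |>.fun_div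
      (d.fun_mul (hasDerivAt_septic_cubic x)) (mul_ne_zero h1 h2)).deriv,
      septic_left_quadratic hr, septicFirst]
    have hT := septic_left_theta_quadratic hr
    generalize hρ : 1 - 7 * x + 14 * x ^ 2 - 7 * x ^ 3 = ρ at h2 hT ⊢
    generalize hb : 1 + (1 - 2 * x) * x ^ 2 * g x = b at h4 hT ⊢
    generalize hS : 1 - 7 * x + 7 * x ^ 2 - 2 * x ^ 4 * g x = S at hG hT ⊢
    push_cast
    -- The first multiple replaces `l p(z)` by a logarithmic derivative; the second eliminates
    -- `deriv g x`.
    linear_combination (norm := (field_simp; ring))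
      -(14 / 3 * b / (ρ * (1 - x) * g x ^ 3)) * hT +
      7 * b ^ 2 / (g x * ρ) * (2 * (1 - 2 * x) * x ^ 3 / b - x / g x) * hG
  · filter_upwards [hne, hrel] with x ⟨h1, h2, h3, h4, h5⟩ hr
    rw [septic_left_quadratic hr, septicZeroth]
    generalize hρ : 1 - 7 * x + 14 * x ^ 2 - 7 * x ^ 3 = ρ at h2 ⊢
    generalize hb : 1 + (1 - 2 * x) * x ^ 2 * g x = b at h4 ⊢
    simp only [deriv_const]
    field_simp
    ring

end SepticODE

section SepticODE

variable {g : ℂ → ℂ}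

theorem septic_multiplier_mem_slitPlane (hg0 : g 0 = 7) :
    (1 - 7 * (0 : ℂ) + 14 * 0 ^ 2 - 7 * 0 ^ 3) ^ 8 * g 0 ^ 12 ∈ Complex.slitPlane := by
  rw [hg0]; norm_num

/-- The factor `7` in the functional equation is exactly what makes both sides agree at `x = 0`. -/
theorem septic_multiplier_zero (hg0 : g 0 = 7) :
    7 * ((1 - 7 * (0 : ℂ) + 14 * 0 ^ 2 - 7 * 0 ^ 3) ^ 8 * g 0 ^ 12) ^ (-(1 / 12) : ℂ) = 1 := by
  have h : ((7 : ℂ) ^ 12) ^ (-(1 / 12) : ℂ) = 7⁻¹ := by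
    have e : ((7 : ℂ) ^ 12) ^ (-(1 / 12) : ℂ) = (((7 : ℝ) ^ 12) ^ (-(1 / 12) : ℝ) : ℝ) := by
      rw [Complex.ofReal_cpow (by positivity)]
      push_cast
      rfl
    rw [e, ← Real.rpow_natCast, ← Real.rpow_mul (by norm_num)]
    norm_num [Real.rpow_neg_one]
  rw [hg0]
  norm_num at h ⊢
  rw [h]
  norm_num

/-- Here `l (z'² + 13z' + 49)^(-2/3)` is, up to a constant, `(1-x)^(-2/3) ρ^(1/3) g^(-1/3)`. The
twist contributes `A²`, proportional to `ρ^(-4/3) g⁻²`, and so restores the first-order coefficient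
of the left side. The zeroth coefficients agree by `septic_zeroth_identity`. -/
theorem septic_right_solvesODE (hg : AnalyticAt ℂ g 0) (hg0 : g 0 = 7)
    (hrel : ∀ᶠ x in 𝓝 0, x ^ 4 * g x ^ 2 - (1 - 7 * x + 7 * x ^ 2) * g x + 7 = 0) :
    SolvesODE (fun x => x * (1 - 7 * x + 7 * x ^ 2 - 2 * x ^ 4 * g x)) (septicFirst g)
      (septicZeroth g)
      (fun x => 7 * ((1 - 7 * x + 14 * x ^ 2 - 7 * x ^ 3) ^ 8 * g x ^ 12) ^ (-(1 / 12) : ℂ) *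
        h7 (x ^ 7 * g x ^ 2 / (1 - 7 * x + 14 * x ^ 2 - 7 * x ^ 3))) := by
  have hne := eventually_septic_ne hg hg0
  have hG := septic_unit_deriv hg hrel
  have hE : AnalyticAt ℂ (fun x => (1 - 7 * x + 14 * x ^ 2 - 7 * x ^ 3) ^ 8 * g x ^ 12) 0 := by
    fun_prop
  have hslit0 := septic_multiplier_mem_slitPlane hg0
  have hslit := hE.continuousAt.eventually_mem (Complex.isOpen_slitPlane.mem_nhds hslit0)
  refine h7_solvesThetaODE.pullback
    (A := fun x => 7 * ((1 - 7 * x + 14 * x ^ 2 - 7 * x ^ 3) ^ 8 * g x ^ 12) ^ (-(1 / 12) : ℂ))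
    (φ := fun x => x ^ 7 * g x ^ 2 / (1 - 7 * x + 14 * x ^ 2 - 7 * x ^ 3))
    (l := fun x => (7 * (1 - 2 * x) + x ^ 2 * g x) ^ 2 /
      (g x * (1 - 7 * x + 14 * x ^ 2 - 7 * x ^ 3)))
    (l₀ := fun x => -(2 / 3) * (x * (1 - 7 * x + 7 * x ^ 2 - 2 * x ^ 4 * g x) *
      (-7 + 28 * x - 21 * x ^ 2) / (1 - 7 * x + 14 * x ^ 2 - 7 * x ^ 3)) -
      x * (7 - 14 * x + 4 * x ^ 3 * g x))
    (analyticAt_const.fun_mul (hE.cpow_const hslit0 _))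
    (AnalyticAt.fun_div (by fun_prop) (by fun_prop) (by simp)) (by simp)
    (AnalyticAt.fun_div (by fun_prop) (by fun_prop) (by simp [hg0]))
    (.fun_sub (.fun_mul analyticAt_const (.fun_div (by fun_prop) (by fun_prop) (by simp)))
      (by fun_prop)) ?_ ?_ ?_ ?_
  · filter_upwards [hne, hG, hslit, hg.eventually_analyticAt]
      with x ⟨h1, h2, h3, h4, h5⟩ hG hslit ha
    have d := ha.differentiableAt.hasDerivAt
    have dE := ((hasDerivAt_septic_cubic x).fun_pow 8).fun_mul (d.fun_pow 12)
    have := deriv_const_cpow_of_mul_deriv_eq (a := -(1 / 12)) dE.differentiableAt hslit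
      (τ := x * (1 - 7 * x + 7 * x ^ 2 - 2 * x ^ 4 * g x))
      (l := 8 * (x * (1 - 7 * x + 7 * x ^ 2 - 2 * x ^ 4 * g x) * (-7 + 28 * x - 21 * x ^ 2) /
        (1 - 7 * x + 14 * x ^ 2 - 7 * x ^ 3)) + 12 * (x * (7 - 14 * x + 4 * x ^ 3 * g x))) (by
        rw [dE.deriv]
        generalize 1 - 7 * x + 14 * x ^ 2 - 7 * x ^ 3 = ρ at h2 ⊢
        generalize 1 - 7 * x + 7 * x ^ 2 - 2 * x ^ 4 * g x = S at hG ⊢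
        push_cast
        linear_combination (norm := (field_simp; ring)) 12 * x * ρ ^ 8 * g x ^ 11 * hG)
    rw [deriv_const_mul_field]
    linear_combination 7 * this
  · filter_upwards [hne, hG, hrel, hg.eventually_analyticAt] with x ⟨h1, h2, h3, h4, h5⟩ hG hr ha
    have d := ha.differentiableAt.hasDerivAt
    rw [(((hasDerivAt_id' x).fun_pow 7).fun_mul (d.fun_pow 2) |>.fun_div
      (hasDerivAt_septic_cubic x) h2).deriv]
    have hL := septic_right_logDeriv hr
    generalize hρ : 1 - 7 * x + 14 * x ^ 2 - 7 * x ^ 3 = ρ at h2 hL ⊢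
    generalize hc : 7 * (1 - 2 * x) + x ^ 2 * g x = c at hL ⊢
    generalize hS : 1 - 7 * x + 7 * x ^ 2 - 2 * x ^ 4 * g x = S at hG hL ⊢
    push_cast
    linear_combination (norm := (field_simp; ring)) x ^ 7 * g x / ρ ^ 2 * hL +
      2 * x ^ 8 * g x / ρ * hG
  · filter_upwards [hne, hG, hrel, hg.eventually_analyticAt] with x ⟨h1, h2, h3, h4, h5⟩ hG hr ha
    have d := ha.differentiableAt.hasDerivAt
    rw [(((hasDerivAt_septic_right_root d).fun_pow 2).fun_div
      (d.fun_mul (hasDerivAt_septic_cubic x)) (mul_ne_zero h1 h2)).deriv,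
      septic_right_quadratic hr h1 h2, septicFirst]
    have hT := septic_right_theta_quadratic hr
    generalize hρ : 1 - 7 * x + 14 * x ^ 2 - 7 * x ^ 3 = ρ at h2 hT ⊢
    generalize hc : 7 * (1 - 2 * x) + x ^ 2 * g x = c at h5 hT ⊢
    generalize hS : 1 - 7 * x + 7 * x ^ 2 - 2 * x ^ 4 * g x = S at hG hT ⊢
    push_cast
    linear_combination (norm := (field_simp; ring))
      -(2 / 3 * c / (ρ ^ 2 * (1 - x) * g x)) * hT +
      c ^ 2 / (g x * ρ) * (2 * x ^ 3 / c - x / g x) * hG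
  · filter_upwards [hne, hG, hrel, hg.eventually_analyticAt] with x ⟨h1, h2, h3, h4, h5⟩ hG hr ha
    have d := ha.differentiableAt.hasDerivAt
    have d0 := hasDerivAt_id' x
    have dS : HasDerivAt (fun x => 1 - 7 * x + 7 * x ^ 2 - 2 * x ^ 4 * g x)
        (-7 + 14 * x - 8 * x ^ 3 * g x - 2 * x ^ 4 * deriv g x) x := by
      refine (((d0.const_mul 7).const_sub 1).fun_add ((d0.fun_pow 2).const_mul 7)).fun_sub
        (((d0.fun_pow 4).const_mul 2).fun_mul d) |>.congr_deriv ?_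
      push_cast; ring
    have dγ : HasDerivAt (fun x => x * (7 - 14 * x + 4 * x ^ 3 * g x))
        (7 - 28 * x + 16 * x ^ 3 * g x + 4 * x ^ 4 * deriv g x) x := by
      refine d0.fun_mul (((d0.const_mul 14).const_sub 7).fun_add
        (((d0.fun_pow 3).const_mul 4).fun_mul d)) |>.congr_deriv ?_
      push_cast; ring
    have dρ : HasDerivAt (fun x : ℂ => -7 + 28 * x - 21 * x ^ 2) (28 - 42 * x) x := by
      refine ((d0.const_mul 28).const_add (-7)).fun_sub ((d0.fun_pow 2).const_mul 21)
        |>.congr_deriv ?_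
      push_cast; ring
    rw [((((d0.fun_mul dS).fun_mul dρ).fun_div (hasDerivAt_septic_cubic x) h2).const_mul
      (-(2 / 3)) |>.fun_sub dγ).deriv, septic_right_quadratic hr h1 h2, septicFirst, septicZeroth]
    have key := septic_zeroth_identity hr rfl rfl rfl rfl rfl rfl rfl rfl rfl rfl rfl
    generalize 1 - 7 * x + 14 * x ^ 2 - 7 * x ^ 3 = ρ at h2 key ⊢
    generalize 7 * (1 - 2 * x) + x ^ 2 * g x = c at h5 key ⊢
    generalize 1 + (1 - 2 * x) * x ^ 2 * g x = b at h4 key ⊢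
    generalize 1 - 7 * x + 7 * x ^ 2 - 2 * x ^ 4 * g x = S at hG key ⊢
    linear_combination (norm := (field_simp; ring))
      1 / (9 * (1 - x) * ρ ^ 2 * g x ^ 2) * key +
      x * (4 / 3 * x ^ 5 * (-7 + 28 * x - 21 * x ^ 2) / ρ - 4 * x ^ 4) * hG

theorem septic_identity_at_infinity (hg : AnalyticAt ℂ g 0) (hg0 : g 0 = 7)
    (hrel : ∀ᶠ x in 𝓝 0, x ^ 4 * g x ^ 2 - (1 - 7 * x + 7 * x ^ 2) * g x + 7 = 0) :
    ∀ᶠ x in 𝓝 0, h7 (x * (1 - 7 * x + 14 * x ^ 2 - 7 * x ^ 3) * g x ^ 2) =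
      7 * ((1 - 7 * x + 14 * x ^ 2 - 7 * x ^ 3) ^ 8 * g x ^ 12) ^ (-(1 / 12) : ℂ) *
        h7 (x ^ 7 * g x ^ 2 / (1 - 7 * x + 14 * x ^ 2 - 7 * x ^ 3)) := by
  have hgc := hg.continuousAt
  have h := (septic_left_solvesODE hg hg0 hrel).eventuallyEq
    (σ := fun x => 1 - 7 * x + 7 * x ^ 2 - 2 * x ^ 4 * g x) (by fun_prop) (by simp) ?_
    (by simp [septicFirst]) (septic_right_solvesODE hg hg0 hrel) (by simp [h7_zero]) ?_
  · filter_upwards [h] with x hx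
    simpa using hx
  · unfold septicFirst
    exact .add (.sub (by fun_prop) (.div (by fun_prop) (by fun_prop) (by simp)))
      (.div (by fun_prop) (by fun_prop) (by simp))
  · rw [septic_multiplier_zero hg0]
    simp [h7_zero]

end SepticODE

/-! ### The branch at infinity and the conclusion -/

/-- Sum and product determine the pair `{z, 49/z'}`. The exchanged choice `w = 49/z'` would give `w
z' = 49`, whereas `w z' → 0`. -/
theorem IsH7Branch.unique {z z' w w' : ℂ → ℂ} (h : IsH7Branch z z')
    (hz' : ∀ᶠ t in Bornology.cobounded ℂ, z' t ≠ 0) (hw : IsH7Branch w w') :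
    ∀ᶠ t in Bornology.cobounded ℂ, w t = z t ∧ w' t = z' t := by
  have ht : Tendsto (fun t => w t * z' t) (Bornology.cobounded ℂ) (𝓝 0) := by
    simpa using hw.tendsto_left.mul h.tendsto_right
  filter_upwards [h.sum_eq, h.prod_eq, hw.sum_eq, hw.prod_eq, hz',
    ht.eventually_ne (show (0 : ℂ) ≠ 49 by norm_num)] with t s1 p1 s2 p2 hz' hne
  have hprod : (w t - z t) * (w t - 49 / z' t) = 0 := by
    linear_combination w t * (s2 - s1) + p1 - p2
  have hwz : w t = z t := by
    rcases mul_eq_zero.1 hprod with h | h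
    · exact sub_eq_zero.1 h
    · refine absurd ?_ hne
      rw [sub_eq_zero.1 h, div_mul_cancel₀ _ hz']
  refine ⟨hwz, ?_⟩
  have : 49 / w' t = 49 / z' t := by linear_combination s2 - s1 - hwz
  rw [div_eq_mul_inv, div_eq_mul_inv] at this
  exact inv_injective (mul_left_cancel₀ (by norm_num) this)

theorem isH7Branch_of_septic_unit {g : ℂ → ℂ} (hg : AnalyticAt ℂ g 0) (hg0 : g 0 = 7)
    (hrel : ∀ᶠ x in 𝓝 0, x ^ 4 * g x ^ 2 - (1 - 7 * x + 7 * x ^ 2) * g x + 7 = 0) :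
    IsH7Branch
      (fun t => t⁻¹ * (1 - 7 * t⁻¹ + 14 * t⁻¹ ^ 2 - 7 * t⁻¹ ^ 3) * g t⁻¹ ^ 2)
      (fun t => t⁻¹ ^ 7 * g t⁻¹ ^ 2 / (1 - 7 * t⁻¹ + 14 * t⁻¹ ^ 2 - 7 * t⁻¹ ^ 3)) := by
  have hinv : Tendsto (fun t : ℂ => t⁻¹) (Bornology.cobounded ℂ) (𝓝 0) := tendsto_inv₀_cobounded
  have hev : ∀ᶠ t in Bornology.cobounded ℂ, ∃ x : ℂ, x ≠ 0 ∧ t = x⁻¹ ∧ g x ≠ 0 ∧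
      1 - 7 * x + 14 * x ^ 2 - 7 * x ^ 3 ≠ 0 ∧
      x ^ 4 * g x ^ 2 - (1 - 7 * x + 7 * x ^ 2) * g x + 7 = 0 := by
    filter_upwards [hinv.eventually (eventually_septic_ne hg hg0), hinv.eventually hrel,
      Bornology.eventually_ne_cobounded (0 : ℂ)] with t h1 h2 h3
    exact ⟨t⁻¹, inv_ne_zero h3, (inv_inv t).symm, h1.1, h1.2.1, h2⟩
  have hgc := hg.continuousAt
  refine ⟨?_, ?_, ?_, ?_⟩
  · filter_upwards [hev] with t ⟨x, hx, ht, hg, hρ, hr⟩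
    subst ht
    simp only [inv_inv]
    have e1 : ((x⁻¹) ^ 3 - 7 * (x⁻¹) ^ 2 + 14 * x⁻¹ - 7) =
        (1 - 7 * x + 14 * x ^ 2 - 7 * x ^ 3) / x ^ 3 := by
      field_simp
    rw [e1]
    generalize 1 - 7 * x + 14 * x ^ 2 - 7 * x ^ 3 = ρ at hρ ⊢
    generalize g x = u at hg hr ⊢
    -- The square of `x⁴u² + 7 = ru`, after moving `14x⁴u²` across; `r² - 14x⁴` is the quartic of
    -- the sum equation in the variable `1/t`.
    have e2 : x ^ 8 * u ^ 4 + 49 = u ^ 2 *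
        ((1 - 7 * x + 7 * x ^ 2) ^ 2 - 14 * x ^ 4) := by
      linear_combination (x ^ 4 * u ^ 2 + (1 - 7 * x + 7 * x ^ 2) * u + 7) * hr
    field_simp
    linear_combination e2
  · filter_upwards [hev] with t ⟨x, hx, ht, hg, hρ, hr⟩
    subst ht
    simp only [inv_inv]
    have e1 : ((x⁻¹) ^ 3 - 7 * (x⁻¹) ^ 2 + 14 * x⁻¹ - 7) =
        (1 - 7 * x + 14 * x ^ 2 - 7 * x ^ 3) / x ^ 3 := by
      field_simp
    rw [e1]
    generalize 1 - 7 * x + 14 * x ^ 2 - 7 * x ^ 3 = ρ at hρ ⊢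
    field_simp
  · have : ContinuousAt (fun x => x * (1 - 7 * x + 14 * x ^ 2 - 7 * x ^ 3) * g x ^ 2) 0 := by
      fun_prop
    have h0 := this.tendsto
    simp only [ne_eq, OfNat.ofNat_ne_zero, not_false_eq_true, zero_pow, zero_mul] at h0
    exact h0.comp hinv
  · have : ContinuousAt (fun x => x ^ 7 * g x ^ 2 / (1 - 7 * x + 14 * x ^ 2 - 7 * x ^ 3)) 0 :=
      .div (by fun_prop) (by fun_prop) (by simp)
    have h0 := this.tendsto
    simp only [ne_eq, OfNat.ofNat_ne_zero, not_false_eq_true, zero_pow, zero_mul, zero_div] at h0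
    exact h0.comp hinv

theorem mainTheorem5 :
    -- the power series converges near `0`
    (∀ᶠ z : ℂ in 𝓝 0, HasSum (fun n : ℕ => h7Coeff n * z ^ n) (h7 z)) ∧
    -- the equivalent hypergeometric definition
    (∀ᶠ z : ℂ in 𝓝 0,
      h7 z = (1 / 49 * (z ^ 2 + 5 * z + 1) ^ 3 * (z ^ 2 + 13 * z + 49)) ^ (-(1 / 12) : ℂ) *
        ordinaryHypergeometric (1 / 12 : ℂ) (5 / 12 : ℂ) (1 : ℂ)
          (1728 * z / ((z ^ 2 + 5 * z + 1) ^ 3 * (z ^ 2 + 13 * z + 49)))) ∧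
    -- the branch exists near `t = ∞`, is analytic there, and is unique
    (∃ z z' : ℂ → ℂ, IsH7Branch z z' ∧
      (∀ᶠ t in Bornology.cobounded ℂ, AnalyticAt ℂ z t ∧ AnalyticAt ℂ z' t) ∧
      ∀ w w' : ℂ → ℂ, IsH7Branch w w' →
        ∀ᶠ t in Bornology.cobounded ℂ, w t = z t ∧ w' t = z' t) ∧
    -- the septic functional equation
    (∀ z z' : ℂ → ℂ, IsH7Branch z z' →
      ∀ᶠ t in Bornology.cobounded ℂ,
        h7 (z t) = 7 * (z t ^ 7 / z' t) ^ (-(1 / 12) : ℂ) * h7 (z' t)) := by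
  obtain ⟨g, hg, hg0, hrel⟩ := exists_septic_unit
  have hB := isH7Branch_of_septic_unit hg hg0 hrel
  have hinv : Tendsto (fun t : ℂ => t⁻¹) (Bornology.cobounded ℂ) (𝓝 0) := tendsto_inv₀_cobounded
  have hne := hinv.eventually (eventually_septic_ne hg hg0)
  have ht0 := Bornology.eventually_ne_cobounded (0 : ℂ)
  have hU := fun w w' => hB.unique (w := w) (w' := w') (by
    filter_upwards [hne, ht0] with t ⟨h1, h2, _⟩ ht
    exact div_ne_zero (mul_ne_zero (pow_ne_zero _ (inv_ne_zero ht)) (pow_ne_zero _ h1)) h2)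
  refine ⟨?_, h7_eventuallyEq_hypergeometric, ⟨_, _, hB, ?_, hU⟩, ?_⟩
  · filter_upwards [Metric.ball_mem_nhds (0 : ℂ) one_pos] with z hz
    exact hasSum_h7 (by simpa using hz)
  · filter_upwards [hne, ht0, hinv.eventually hg.eventually_analyticAt] with t ⟨_, h2, _⟩ ht ha
    have hi : AnalyticAt ℂ (fun t : ℂ => t⁻¹) t := analyticAt_inv ht
    have hgi : AnalyticAt ℂ (fun t : ℂ => g t⁻¹) t := ha.fun_comp hi
    exact ⟨by fun_prop, .fun_div (by fun_prop) (by fun_prop) h2⟩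
  · intro w w' hw
    filter_upwards [hU w w' hw, hne, ht0,
      hinv.eventually (septic_identity_at_infinity hg hg0 hrel)] with t ⟨e1, e2⟩ ⟨h1, h2, _⟩ ht h
    rw [e1, e2, h]
    -- The base `z⁷/z'` equals `ρ⁸g¹²` exactly, so the two principal powers coincide and no branch
    -- question arises.
    congr 3
    have hx := inv_ne_zero ht
    generalize t⁻¹ = x at hx h1 h2 ⊢
    generalize 1 - 7 * x + 14 * x ^ 2 - 7 * x ^ 3 = ρ at h2 ⊢
    field_simp
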